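/- Let $X$ be a finite set and let $r\colon X\times X\to X\times X$, $r(x,y)=(\sigma_x(y),\tau_y(x))$, be a bijective map satisfying the Yang--Baxter equation $r_1r_2r_1=r_2r_1r_2$ on $X\times X\times X$, where $r_1=r\times\mathrm{Id}_X$ and $r_2=\mathrm{Id}_X\times r$, and such that all the maps $\sigma_x,\tau_y\colon X\to X$ are bijective. Let \[G_{(X,r)}=\langle X \mid xy=\sigma_x(y)\,\tau_y(x)\ \text{ for all } x,y\in X\rangle\] be its structure group, and let $K_r$ be the number of orbits of its structure rack, that is, of $X$ under the permutations $x\mapsto x\triangleleft_r y:=\tau_y\bigl(\sigma_{\tau_x^{-1}(y)}(x)\bigr)$, $y\in X$. Then: \begin{enumerate} \item $G_{(X,r)}$ is virtually $\mathbb{Z}^{K_r}$, i.e. it has a subgroup of finite index isomorphic to $\mathbb{Z}^{K_r}$; \item $G_{(X,r)}$ is linear: it embeds into $\mathrm{GL}_n(\mathbb{R})$ for some $n$. Moreover, there are a normal subgroup $Z\cong\mathbb{Z}^{K_r}$ of finite index in $G_{(X,r)}$ and a faithful representation of $Z$ on $\mathbb{R}^{K_r}$ such that the representation of $G_{(X,r)}$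 induced from it is faithful; \item $G_{(X,r)}$ is residually finite: the intersection of its normal subgroups of finite index is trivial. \end{enumerate} -/

import Mathlib

/-- An invertible non-degenerate set-theoretic solution `(X, r)` of the Yang--Baxter equation,
`r (x, y) = (σ_x y, τ_y x)`. (Finiteness of `X` is imposed separately.) -/
structure YBESolution (X : Type*) where
  /-- the bijective map `r` -/
  r : X × X ≃ X × X
  /-- the Yang--Baxter equation `r₁ r₂ r₁ = r₂ r₁ r₂` on `X × X × X`,
  where `r₁ = r × id` and `r₂ = id × r` -/
  yangBaxter :
    let r₁ : X × X × X → X × X × X := fun t =>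
      ((r (t.1, t.2.1)).1, (r (t.1, t.2.1)).2, t.2.2)
    let r₂ : X × X × X → X × X × X := fun t => (t.1, r t.2)
    r₁ ∘ r₂ ∘ r₁ = r₂ ∘ r₁ ∘ r₂
  /-- every `σ_x : y ↦ (r (x, y)).1` is bijective -/
  bijective_left : ∀ x : X, Function.Bijective fun y : X => (r (x, y)).1
  /-- every `τ_y : x ↦ (r (x, y)).2` is bijective -/
  bijective_right : ∀ y : X, Function.Bijective fun x : X => (r (x, y)).2

namespace YBESolution

variable {X : Type*} (S : YBESolution X)

/-- The permutation `σ_x : y ↦ (r (x, y)).1`. -/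
noncomputable def sigma (x : X) : Equiv.Perm X :=
  Equiv.ofBijective (fun y : X => (S.r (x, y)).1) (S.bijective_left x)

/-- The permutation `τ_y : x ↦ (r (x, y)).2`. -/
noncomputable def tau (y : X) : Equiv.Perm X :=
  Equiv.ofBijective (fun x : X => (S.r (x, y)).2) (S.bijective_right y)

/-- The structure group `⟨X | x y = σ_x(y) τ_y(x) for all x, y ∈ X⟩`. -/
abbrev StructureGroup : Type _ :=
  PresentedGroup {w : FreeGroup X | ∃ x y : X,
    w = (FreeGroup.of x * FreeGroup.of y) *
      (FreeGroup.of (S.sigma x y) * FreeGroup.of (S.tau y x))⁻¹}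

/-- The operation of the (right) structure rack: `x ◁ y = τ_y (σ_{τ_x⁻¹(y)} (x))`. -/
noncomputable def rackOp (x y : X) : X :=
  S.tau y (S.sigma ((S.tau x).symm y) x)

/-- The partition of `X` into orbits of the structure rack: the equivalence relation generated by
`x ∼ x ◁ y` for all `x, y`. As the maps `x ↦ x ◁ y` are permutations of `X`, its classes are the
orbits of the group that these permutations generate. -/
def rackOrbitRel : Setoid X :=
  Relation.EqvGen.setoid fun x x' : X => ∃ y : X, x' = S.rackOp x y

/-- The number `K_r` of orbits of the structure rack. -/
noncomputable def numRackOrbits : ℕ := Nat.card (Quotient S.rackOrbitRel)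

end YBESolution

/-- The group `G` is virtually `A`: it has a subgroup of finite index isomorphic to `A`. -/
def IsVirtually (G A : Type*) [Group G] [Group A] : Prop :=
  ∃ H : Subgroup G, H.FiniteIndex ∧ Nonempty (H ≃* A)

/-- The group `G` is linear over the field `k`: it embeds into `GL_n(k)` for some `n`. -/
def IsLinearGroup (k G : Type*) [Field k] [Group G] : Prop :=
  ∃ (n : ℕ) (f : G →* Matrix.GeneralLinearGroup (Fin n) k), Function.Injective f

/-! The structure group `G` acts on `X` with `x` acting as `τ_x⁻¹`, and this action respects the
rack. Write `g • x` for it. The maps `g ↦ (g • x) g` are permutations of `G` satisfying the rack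
relations (`shift_mul_shift`). They generate a group `A` that is transitive on `G` and commutes with
right translations by the finite-index kernel `H` of the action on `X`. So `G` is compared with `A`.

A finite generating set of `A` is closed under conjugation, so the center has some finite index `n`.
The transfer `a ↦ a ^ n` into the center takes one value per rack orbit, which gives `ζ : ℤ^(K_r) →
A` with image of finite index. An affine action of `G` on `ℤ^(K_r)` yields a degree under which the
permutation attached to `x` adds the basis vector `[x]`. Degree after `ζ` is multiplication by `n`,
so the image of `ζ` acts freely at `1 : G`. The elements of `H` in the `ζ`-orbit of `1` then form a
finite-index subgroup of `G` embedding in `ℤ^(K_r)` with finite index.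

Linearity follows by inducing a faithful representation from a normal `ℤ^(K_r)`; residual finiteness
passes up from a finite-index subgroup. -/

/-! ### Finite-index criteria and the transfer argument -/

/-- A subgroup has finite index if its left cosets are separated by a function with finite
codomain. -/
theorem Subgroup.finiteIndex_of_separating {G T : Type*} [Group G] [Finite T] (K : Subgroup G)
    (φ : G → T) (h : ∀ a b, φ a = φ b → a⁻¹ * b ∈ K) : K.FiniteIndex := by
  have : Finite (G ⧸ K) := by
    refine Finite.of_injective (fun q : G ⧸ K => φ q.out) fun p q hpq => ?_
    rw [← QuotientGroup.out_eq' p, ← QuotientGroup.out_eq' q]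
    exact QuotientGroup.eq.mpr (h _ _ hpq)
  exact Subgroup.finiteIndex_of_finite_quotient

/-- A group generated by a finite family whose range is closed under conjugation by its members
has a center of finite index. -/
theorem finiteIndex_center_of_conj_closed {A X : Type*} [Group A] [Finite X] (P : X → A)
    (op : X → X → X) (hop : ∀ x y, P x * P y = P (op y x) * P x)
    (hgen : Subgroup.closure (Set.range P) = ⊤) : (Subgroup.center A).FiniteIndex := by
  have hnorm : ∀ a : A, ∀ e ∈ Set.range P, a * e * a⁻¹ ∈ Set.range P := by
    have hle : Subgroup.closure (Set.range P) ≤ Subgroup.normalizer (Set.range P) := by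
      rw [Subgroup.closure_le]
      rintro _ ⟨x, rfl⟩
      refine Subgroup.mem_normalizer_fintype ?_
      rintro _ ⟨y, rfl⟩
      exact ⟨op y x, by rw [hop, mul_inv_cancel_right]⟩
    intro a e he
    have ha : a ∈ Subgroup.normalizer (Set.range P) := hle (hgen ▸ Subgroup.mem_top a)
    exact (Subgroup.mem_set_normalizer_iff.mp ha e).mp he
  let act : MulAction A (Set.range P) :=
    { smul := fun a e => ⟨a * e * a⁻¹, hnorm a e e.2⟩
      one_smul := fun e => Subtype.ext (by change 1 * (e : A) * 1⁻¹ = e; simp)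
      mul_smul := fun a b e => Subtype.ext (by
        change a * b * (e : A) * (a * b)⁻¹ = a * (b * e * b⁻¹) * a⁻¹
        group) }
  -- The kernel of conjugation on the finite generating set centralizes every generator, hence is
  -- central.
  have hfin : (MulAction.toPermHom A (Set.range P)).ker.FiniteIndex := Subgroup.finiteIndex_ker _
  refine Subgroup.finiteIndex_of_le (H := (MulAction.toPermHom A (Set.range P)).ker) fun a ha => ?_
  have hcomm : ∀ x, a * P x * a⁻¹ = P x := fun x =>
    congrArg Subtype.val (DFunLike.congr_fun (MonoidHom.mem_ker.mp ha)
      (⟨P x, x, rfl⟩ : Set.range P))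
  have hle : Subgroup.closure (Set.range P) ≤ Subgroup.centralizer {a} := by
    rw [Subgroup.closure_le]
    rintro _ ⟨x, rfl⟩
    rw [SetLike.mem_coe, Subgroup.mem_centralizer_singleton_iff]
    exact (mul_inv_eq_iff_eq_mul.mp (hcomm x)).symm
  rw [Subgroup.mem_center_iff]
  intro b
  exact Subgroup.mem_centralizer_singleton_iff.mp (hle (hgen ▸ Subgroup.mem_top b))

/-- In a finitely generated commutative group, a subgroup that contains a positive power of every
element has finite index. -/
theorem Subgroup.finiteIndex_of_pow_mem {C : Type*} [CommGroup C] [Group.FG C] (K : Subgroup C)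
    {n : ℕ} (hn : n ≠ 0) (h : ∀ c : C, c ^ n ∈ K) : K.FiniteIndex := by
  have htor : IsMulTorsion (C ⧸ K) := by
    intro q
    obtain ⟨c, rfl⟩ := QuotientGroup.mk_surjective q
    refine isOfFinOrder_iff_pow_eq_one.mpr ⟨n, Nat.pos_of_ne_zero hn, ?_⟩
    rw [← QuotientGroup.mk_pow]
    exact (QuotientGroup.eq_one_iff _).mpr (h c)
  have : Finite (C ⧸ K) := CommGroup.finite_of_fg_isMulTorsion _ htor
  exact Subgroup.finiteIndex_of_finite_quotient

open scoped IsMulCommutative in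
/-- A group generated by a finite family with `P x * P y = P (op y x) * P x`, whose generators are
counted by class by a homomorphism `δ`, contains a finite-index free abelian group on the classes
of `op`. -/
theorem exists_freeAbelian_finiteIndex {A X : Type*} [Group A] [Finite X] (P : X → A)
    (op : X → X → X) (hop : ∀ x y, P x * P y = P (op y x) * P x)
    (hgen : Subgroup.closure (Set.range P) = ⊤) (s : Setoid X)
    (hs : s = Relation.EqvGen.setoid fun x x' : X => ∃ y, x' = op x y) [DecidableEq (Quotient s)]
    (δ : A →* Multiplicative (Quotient s → ℤ))
    (hδ : ∀ x, δ (P x) = Multiplicative.ofAdd (Pi.single (Quotient.mk s x) 1)) :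
    ∃ ζ : Multiplicative (Quotient s → ℤ) →* A,
      ζ.range.FiniteIndex ∧ Function.Injective (δ.comp ζ) := by
  have hC := finiteIndex_center_of_conj_closed P op hop hgen
  have hFG : Group.FG A := ⟨⟨(Set.finite_range P).toFinset, by simpa using hgen⟩⟩
  have := Fintype.ofFinite (Quotient s)
  set n := (Subgroup.center A).index with hn
  have hn0 : n ≠ 0 := hC.index_ne_zero
  -- The transfer to the center makes `a ↦ a ^ n` a homomorphism. Its target is commutative, so it
  -- cannot tell conjugate generators apart.
  let T := MonoidHom.transferCenterPow A
  have hT : ∀ a, (T a : A) = a ^ n := MonoidHom.transferCenterPow_apply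
  have hTop : ∀ x y, T (P (op y x)) = T (P y) := by
    intro x y
    have := congrArg T (hop x y)
    rw [map_mul, map_mul, mul_comm] at this
    exact (mul_right_cancel this).symm
  have hrel : ∀ x y, s x y → T (P x) = T (P y) := by
    intro x y hxy
    subst hs
    change Relation.EqvGen (fun x x' : X => ∃ y, x' = op x y) x y at hxy
    clear hδ δ
    induction hxy with
    | rel x y h => obtain ⟨w, rfl⟩ := h; exact (hTop w x).symm
    | refl => rfl
    | symm _ _ _ ih => exact ih.symm
    | trans _ _ _ _ _ ih₁ ih₂ => exact ih₁.trans ih₂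
  let z : Quotient s → Subgroup.center A := Quotient.lift (fun x => T (P x)) hrel
  let ζ₀ : Multiplicative (Quotient s → ℤ) →* Subgroup.center A :=
    { toFun := fun m => ∏ q, z q ^ (Multiplicative.toAdd m q)
      map_one' := by simp
      map_mul' := fun a b => by simp [zpow_add, Finset.prod_mul_distrib] }
  have hζ₀ : ∀ x, ζ₀ (Multiplicative.ofAdd (Pi.single (Quotient.mk s x) 1)) = T (P x) := by
    intro x
    change ∏ q, z q ^ ((Pi.single (Quotient.mk s x) 1 : Quotient s → ℤ) q) = _
    rw [Finset.prod_eq_single (Quotient.mk s x)]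
    · simp [z]
    · intro q _ hq; simp [hq]
    · simp
  have hTrange : ∀ a, T a ∈ ζ₀.range := by
    have hle : Subgroup.closure (Set.range P) ≤ ζ₀.range.comap T := by
      rw [Subgroup.closure_le]
      rintro _ ⟨x, rfl⟩
      exact ⟨_, hζ₀ x⟩
    exact fun a => hle (hgen ▸ Subgroup.mem_top a)
  have hfin₀ : ζ₀.range.FiniteIndex := by
    refine Subgroup.finiteIndex_of_pow_mem _ hn0 fun c => ?_
    convert hTrange c
    exact Subtype.ext (by simp [hT])
  refine ⟨(Subgroup.center A).subtype.comp ζ₀, ⟨?_⟩, ?_⟩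
  · rw [MonoidHom.range_comp, Subgroup.index_map_subtype]
    exact mul_ne_zero hfin₀.index_ne_zero hn0
  · have hz : ∀ q, δ (z q) = Multiplicative.ofAdd (Pi.single q 1) ^ n := by
      intro q
      obtain ⟨x, rfl⟩ := Quotient.exists_rep q
      change δ (T (P x)) = _
      rw [hT, map_pow, hδ]
    have hpow : ∀ m, δ (ζ₀ m) = m ^ n := by
      intro m
      change δ.comp (Subgroup.center A).subtype (∏ q, z q ^ (Multiplicative.toAdd m q)) = _
      simp only [map_prod, map_zpow, MonoidHom.comp_apply, Subgroup.subtype_apply, hz]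
      apply Multiplicative.toAdd.injective
      ext q
      simp [toAdd_prod, toAdd_zpow, toAdd_pow, Finset.sum_apply, Pi.single_apply, mul_comm]
    intro a b hab
    have hab : a ^ n = b ^ n := by rw [← hpow, ← hpow]; exact hab
    have hab : n • Multiplicative.toAdd a = n • Multiplicative.toAdd b := hab
    exact Multiplicative.toAdd.injective (smul_right_injective _ hn0 hab)

/-- Suppose that `A` acts transitively on the set `G`, commuting with the right translations by a
finite-index subgroup `H`, and that `M` maps to `A` with finite-index range and acts freely. Then
some finite-index subgroup of `G` embeds into `M` with finite index. -/
theorem exists_finiteIndex_embedding_of_action {G A M : Type*} [Group G] [Group A] [Group M]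
    [MulAction A G] (H : Subgroup G) [H.FiniteIndex]
    (hH : ∀ (a : A) (g h : G), h ∈ H → a • (g * h) = (a • g) * h)
    (htrans : ∀ g : G, ∃ a : A, a • (1 : G) = g) (ζ : M →* A) (hζ : ζ.range.FiniteIndex)
    (hfree : ∀ m, ζ m • (1 : G) = 1 → m = 1) :
    ∃ (K : Subgroup G) (f : K →* M),
      K.FiniteIndex ∧ Function.Injective f ∧ f.range.FiniteIndex := by
  have hH1 : ∀ (a : A) (h : G), h ∈ H → a • h = (a • (1 : G)) * h := fun a h hh => by
    rw [← hH a 1 h hh, one_mul]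
  -- For `h ∈ H`, `a • h = (a • 1) * h`, so on elements of `H` the map `m ↦ ζ m • 1` turns products
  -- into products.
  let K : Subgroup G :=
    { carrier := {h | h ∈ H ∧ ∃ m, ζ m • (1 : G) = h}
      one_mem' := ⟨H.one_mem, 1, by simp⟩
      mul_mem' := by
        rintro _ b ⟨ha, m, rfl⟩ ⟨hb, m', hm'⟩
        exact ⟨H.mul_mem ha hb, m * m', by rw [map_mul, mul_smul, hm', hH1 _ _ hb]⟩
      inv_mem' := by
        rintro a ⟨ha, m, hm⟩
        refine ⟨H.inv_mem ha, m⁻¹, ?_⟩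
        rw [map_inv, inv_smul_eq_iff, hH1 _ _ (H.inv_mem ha), hm, mul_inv_cancel] }
  have huniq : ∀ m m', ζ m • (1 : G) = ζ m' • (1 : G) → m = m' := by
    intro m m' h
    have : ζ (m'⁻¹ * m) • (1 : G) = 1 := by
      rw [map_mul, mul_smul, h, map_inv, inv_smul_smul]
    exact (inv_mul_eq_one.mp (hfree _ this)).symm
  choose c hc using fun k : K => k.2.2
  let f : K →* M := MonoidHom.mk' c fun a b => huniq _ _ (by
    rw [hc, map_mul, mul_smul, hc, hH1 _ _ b.2.1, hc]; rfl)
  refine ⟨K, f, ⟨?_⟩, ?_, ?_⟩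
  · have hrel : (K.subgroupOf H).FiniteIndex := by
      choose α hα using htrans
      -- The inverses suit left cosets: if `a` and `b` share a value, some `ζ m` carries `b⁻¹` to
      -- `a⁻¹`, so `ζ m • 1 = a⁻¹ * b`.
      refine Subgroup.finiteIndex_of_separating (T := A ⧸ ζ.range) _
        (fun h : H => ((α (h : G)⁻¹)⁻¹ : A)) fun a b hab => ?_
      obtain ⟨m, hm⟩ := QuotientGroup.eq.mp hab
      rw [inv_inv] at hm
      refine Subgroup.mem_subgroupOf.mpr ⟨(a⁻¹ * b).2, m, ?_⟩
      have h1 : ζ m • (b : G)⁻¹ = (a : G)⁻¹ := by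
        rw [hm, mul_smul, inv_smul_eq_iff.mpr (hα _).symm, hα]
      rw [hH1 _ _ (H.inv_mem b.2), mul_inv_eq_iff_eq_mul] at h1
      exact h1
    have hle : K ≤ H := fun k hk => hk.1
    rw [← Subgroup.relIndex_mul_index hle]
    exact mul_ne_zero hrel.index_ne_zero Subgroup.FiniteIndex.index_ne_zero
  · intro a b hab
    exact Subtype.ext (by rw [← hc a, ← hc b]; exact congrArg (fun m => ζ m • (1 : G)) hab)
  · refine Subgroup.finiteIndex_of_separating (T := G ⧸ H) _
      (fun m => ((ζ m • (1 : G) : G) : G ⧸ H)) fun a b hab => ?_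
    have hab := QuotientGroup.eq.mp hab
    have hk : ζ (a⁻¹ * b) • (1 : G) = (ζ a • (1 : G))⁻¹ * (ζ b • (1 : G)) := by
      rw [map_mul, mul_smul, map_inv, inv_smul_eq_iff, hH1 _ _ hab, mul_inv_cancel_left]
    exact ⟨⟨_, hab, _, hk⟩, huniq _ _ ((hc _).trans hk.symm)⟩

/-- A group that embeds into `ℤ^ι` with finite index is isomorphic to it. -/
theorem nonempty_mulEquiv_of_finiteIndex_range {B ι : Type*} [Group B] [Finite ι]
    (f : B →* Multiplicative (ι → ℤ)) (hf : Function.Injective f) (h : f.range.FiniteIndex) :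
    Nonempty (B ≃* Multiplicative (Fin (Nat.card ι) → ℤ)) := by
  have := Fintype.ofFinite ι
  let R : AddSubgroup (ι → ℤ) := Subgroup.toAddSubgroup' f.range
  have hR : R.FiniteIndex := ⟨h.index_ne_zero⟩
  have hrank := AddSubgroup.finrank_eq_of_finiteIndex R
  rw [Module.finrank_fintype_fun_eq_card, ← Nat.card_eq_fintype_card] at hrank
  let b := Module.finBasisOfFinrankEq ℤ R.toIntSubmodule hrank
  let e₁ : f.range ≃* Multiplicative R := MulEquiv.refl f.range
  exact ⟨(MonoidHom.ofInjective hf).trans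
    (e₁.trans (AddEquiv.toMultiplicative b.equivFun.toAddEquiv))⟩

/-! ### Induced representations and linearity -/

open Representation in
/-- The functional on `IndV` that reads off the component of the trivial coset. -/
theorem exists_indV_component {k G V : Type*} [CommRing k] [Group G] [AddCommGroup V]
    [Module k V] (Z : Subgroup G) (ρ : Representation k Z V) :
    ∃ Φ : IndV Z.subtype ρ →ₗ[k] V, (∀ (z : Z) v, Φ (IndV.mk Z.subtype ρ (z : G) v) = ρ z⁻¹ v) ∧
      ∀ g ∉ Z, ∀ v, Φ (IndV.mk Z.subtype ρ g v) = 0 := by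
  classical
  let c : G → V →ₗ[k] V := fun g => if h : g ∈ Z then ρ ⟨g, h⟩⁻¹ else 0
  let L : MonoidAlgebra k G →ₗ[k] V →ₗ[k] V :=
    Finsupp.linearCombination k c ∘ₗ (MonoidAlgebra.coeffLinearEquiv k).toLinearMap
  have hL : ∀ g r, L (MonoidAlgebra.single g r) = r • c g := fun g r => by
    simp [L]
  have hinv : ∀ z : Z, TensorProduct.lift L ∘ₗ
      Representation.tprod ((leftRegular k G).comp Z.subtype) ρ z = TensorProduct.lift L := by
    intro z
    ext g v
    have hc : c (z * g) (ρ z v) = c g v := by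
      by_cases hg : g ∈ Z
      · have hzg : (z : G) * g ∈ Z := Z.mul_mem z.2 hg
        have : ρ (⟨(z : G) * g, hzg⟩⁻¹ : Z) (ρ z v) = ρ (⟨g, hg⟩⁻¹ : Z) v := by
          rw [← Module.End.mul_apply, ← map_mul]
          congr 2
          ext; simp
        simpa [c, hg, hzg] using this
      · have hzg : (z : G) * g ∉ Z := fun h => hg ((Z.mul_mem_cancel_left z.2).mp h)
        simp [c, hg, hzg]
    simpa [hL] using hc
  refine ⟨Coinvariants.lift _ (TensorProduct.lift L) hinv, fun z v => ?_, fun g hg v => ?_⟩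
  · simp [hL, c]
  · simp [hL, c, hg]

open Representation in
/-- The representation induced from a faithful representation on a nontrivial module is
faithful. -/
theorem ind_injective {k G V : Type*} [CommRing k] [Group G] [AddCommGroup V] [Module k V]
    [Nontrivial V] (Z : Subgroup G) (ρ : Representation k Z V) (hρ : Function.Injective ρ) :
    Function.Injective (ind Z.subtype ρ) := by
  obtain ⟨Φ, hΦ, hΦ0⟩ := exists_indV_component Z ρ
  rw [injective_iff_map_eq_one]
  intro g hg
  have h1 : ∀ v, Φ (IndV.mk Z.subtype ρ g⁻¹ v) = v := by
    intro v
    have h2 := LinearMap.congr_fun hg (IndV.mk Z.subtype ρ 1 v)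
    rw [ind_mk, one_mul] at h2
    rw [h2, Module.End.one_apply]
    simpa using hΦ 1 v
  -- If `g⁻¹ ∈ Z`, then `ρ g = 1` and faithfulness applies; otherwise `h1` forces every `v` to
  -- vanish.
  by_cases hgZ : g⁻¹ ∈ Z
  · have h3 : ρ ⟨g⁻¹, hgZ⟩⁻¹ = 1 := LinearMap.ext fun v => (hΦ ⟨g⁻¹, hgZ⟩ v).symm.trans (h1 v)
    have h4 := congrArg Subtype.val (hρ (h3.trans (map_one ρ).symm))
    simpa using h4
  · obtain ⟨v, hv⟩ := exists_ne (0 : V)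
    exact absurd ((h1 v).symm.trans (hΦ0 _ hgZ v)) hv

open Representation in
/-- Induction from a finite-index subgroup preserves finite generation. -/
theorem finite_indV {k G V : Type*} [CommRing k] [Group G] [AddCommGroup V] [Module k V]
    [Module.Finite k V] (Z : Subgroup G) [Z.FiniteIndex] (ρ : Representation k Z V) :
    Module.Finite k (IndV Z.subtype ρ) := by
  have := Fintype.ofFinite (G ⧸ Z)
  let F : (G ⧸ Z → V) →ₗ[k] IndV Z.subtype ρ :=
    ∑ q, IndV.mk Z.subtype ρ (q.out)⁻¹ ∘ₗ LinearMap.proj q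
  have hF : ∀ g v, IndV.mk Z.subtype ρ g v ∈ F.range := by
    classical
    intro g v
    let q : G ⧸ Z := (g⁻¹ : G)
    obtain ⟨z, hz⟩ := QuotientGroup.mk_out_eq_mul Z g⁻¹
    refine ⟨Pi.single q (ρ z⁻¹ v), ?_⟩
    have h1 : F (Pi.single q (ρ z⁻¹ v)) = IndV.mk Z.subtype ρ (q.out)⁻¹ (ρ z⁻¹ v) := by
      simp only [F, LinearMap.sum_apply, LinearMap.comp_apply, LinearMap.proj_apply]
      rw [Finset.sum_eq_single q]
      · simp
      · intro p _ hp; simp [hp]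
      · simp
    have h2 : (q.out)⁻¹ = (z : G)⁻¹ * g := by
      rw [hz]; group
    rw [h1, h2]
    simp
  have htop : F.range = ⊤ := by
    rw [← Submodule.ker_mkQ F.range, LinearMap.ker_eq_top]
    ext g v
    simpa using hF g v
  exact Module.Finite.of_surjective F (LinearMap.range_eq_top.mp htop)

/-- A group with a faithful finite-dimensional representation is linear. -/
theorem isLinearGroup_of_injective {k G V : Type*} [Field k] [Group G] [AddCommGroup V]
    [Module k V] [Module.Finite k V] (ρ : Representation k G V) (hρ : Function.Injective ρ) :
    IsLinearGroup k G := by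
  let e := LinearMap.toMatrixAlgEquiv (Module.finBasis k V)
  refine ⟨_, (e.toMulEquiv.toMonoidHom.comp ρ).toHomUnits, fun a b hab => ?_⟩
  exact hρ (e.injective (congrArg Units.val hab))

/-- The diagonal representation of `ℤ^n` in which the `i`-th generator scales the `i`-th coordinate
by two. -/
theorem exists_faithful_representation {Z : Type*} [Group Z] {n : ℕ}
    (e : Z ≃* Multiplicative (Fin n → ℤ)) :
    ∃ ρ : Representation ℝ Z (Fin n → ℝ), Function.Injective ρ := by
  let d : Multiplicative (Fin n → ℤ) →* (Fin n → ℝ) :=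
    { toFun := fun m i => (2 : ℝ) ^ (Multiplicative.toAdd m i)
      map_one' := by ext; simp
      map_mul' := fun a b => by ext i; simp [zpow_add₀] }
  let r : Representation ℝ Z (Fin n → ℝ) :=
    ((Algebra.lmul ℝ (Fin n → ℝ) : (Fin n → ℝ) →* Module.End ℝ (Fin n → ℝ)).comp d).comp
      (e : Z →* Multiplicative (Fin n → ℤ))
  refine ⟨r, fun a b hab => e.injective ?_⟩
  have h1 : d (e a) = d (e b) := by
    have := LinearMap.congr_fun hab 1
    simpa [r] using this
  apply Multiplicative.toAdd.injective
  ext i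
  exact zpow_right_injective₀ (by norm_num : (0 : ℝ) < 2) (by norm_num) (congrFun h1 i)

/-! ### Residual finiteness and consequences of being virtually `ℤ^n` -/

theorem residuallyFinite_of_mulEquiv_pi_int {Z ι : Type*} [Group Z]
    (e : Z ≃* Multiplicative (ι → ℤ)) : Group.ResiduallyFinite Z := by
  refine Group.residuallyFinite_of_forall_exists_finite_monoidHom fun z hz => ?_
  obtain ⟨i, hi⟩ : ∃ i, Multiplicative.toAdd (e z) i ≠ 0 := by
    by_contra! h
    exact hz (e.injective ((Multiplicative.toAdd.injective (funext h)).trans (map_one e).symm))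
  -- A modulus exceeding the nonzero coordinate in absolute value cannot divide it.
  let m := (Multiplicative.toAdd (e z) i).natAbs + 1
  let f : (ι → ℤ) →+ ZMod m := (Int.castAddHom (ZMod m)).comp (Pi.evalAddMonoidHom _ i)
  refine ⟨Multiplicative (ZMod m), inferInstance, inferInstance,
    (AddMonoidHom.toMultiplicative f).comp e.toMonoidHom, fun h => hi ?_⟩
  have h : ((Multiplicative.toAdd (e z) i : ℤ) : ZMod m) = 0 := h
  rw [ZMod.intCast_zmod_eq_zero_iff_dvd] at h
  exact Int.eq_zero_of_abs_lt_dvd h (by simp only [m]; push_cast; omega)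

/-- A group with a residually finite subgroup of finite index is residually finite. -/
theorem residuallyFinite_of_finiteIndex {G : Type*} [Group G] (Z : Subgroup G) [Z.FiniteIndex]
    [hZ : Group.ResiduallyFinite Z] : Group.ResiduallyFinite G := by
  rw [Group.residuallyFinite_iff_exists_finiteIndex] at hZ ⊢
  intro g hg
  by_cases hgZ : g ∈ Z
  · obtain ⟨H, hH, hgH⟩ := hZ ⟨g, hgZ⟩ (fun h => hg (congrArg Subtype.val h))
    refine ⟨H.map Z.subtype, ⟨?_⟩, ?_⟩
    · rw [Subgroup.index_map_subtype]
      exact mul_ne_zero hH.index_ne_zero Subgroup.FiniteIndex.index_ne_zero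
    · rintro ⟨z, hz, rfl⟩
      exact hgH hz
  · exact ⟨Z, inferInstance, hgZ⟩

/-- A virtually `ℤ^n` group has a normal subgroup of finite index isomorphic to `ℤ^n`. -/
theorem IsVirtually.exists_normal {G : Type*} [Group G] {n : ℕ}
    (h : IsVirtually G (Multiplicative (Fin n → ℤ))) :
    ∃ Z : Subgroup G, Z.Normal ∧ Z.FiniteIndex ∧
      Nonempty (Z ≃* Multiplicative (Fin n → ℤ)) := by
  obtain ⟨H, hH, ⟨e⟩⟩ := h
  refine ⟨H.normalCore, inferInstance, inferInstance, ?_⟩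
  let i := Subgroup.inclusion H.normalCore_le
  have hi : i.range.FiniteIndex := by
    rw [Subgroup.inclusion_range]
    infer_instance
  have hf : (e.toMonoidHom.comp i).range.FiniteIndex := by
    rw [MonoidHom.range_comp]
    refine ⟨?_⟩
    rw [Subgroup.index_map_of_bijective e.bijective]
    exact hi.index_ne_zero
  have := nonempty_mulEquiv_of_finiteIndex_range (e.toMonoidHom.comp i)
    (e.injective.comp (Subgroup.inclusion_injective _)) hf
  rwa [Nat.card_fin] at this

/-- The consequences of being virtually `ℤ^n`: linearity, a faithful representation induced from
a finite-index `ℤ^n`, and residual finiteness. -/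
theorem IsVirtually.linear_and_residuallyFinite {G : Type*} [Group G] {n : ℕ}
    (h : IsVirtually G (Multiplicative (Fin n → ℤ))) (hn : n = 0 → Subsingleton G) :
    (IsLinearGroup ℝ G ∧
      ∃ Z : Subgroup G, Z.Normal ∧ Z.FiniteIndex ∧
        Nonempty (Z ≃* Multiplicative (Fin n → ℤ)) ∧
        ∃ ρ : Representation ℝ Z (Fin n → ℝ),
          Function.Injective ρ ∧ Function.Injective (Representation.ind Z.subtype ρ)) ∧
    Group.ResiduallyFinite G := by
  obtain ⟨Z, hZn, hZ, ⟨e⟩⟩ := h.exists_normal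
  obtain ⟨ρ, hρ⟩ := exists_faithful_representation e
  have hind : Function.Injective (Representation.ind Z.subtype ρ) := by
    -- For `n = 0` the induced module is zero, so faithfulness needs `G` trivial.
    rcases Nat.eq_zero_or_pos n with h0 | hpos
    · have := hn h0
      exact Function.injective_of_subsingleton _
    · have : Nonempty (Fin n) := ⟨⟨0, hpos⟩⟩
      exact ind_injective Z ρ hρ
  have := finite_indV Z ρ
  have hres := residuallyFinite_of_mulEquiv_pi_int e
  exact ⟨⟨isLinearGroup_of_injective _ hind, Z, hZn, hZ, ⟨e⟩, ρ, hρ, hind⟩,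
    residuallyFinite_of_finiteIndex Z⟩

/-! ### The action through `τ` and the shifts -/

namespace YBESolution

variable {X : Type*} (S : YBESolution X)

/-- The first and last components of the Yang--Baxter equation are the action laws for `σ` and
`τ`; the middle one is a compatibility. -/
theorem yangBaxter_components (u x z : X) :
    S.sigma (S.sigma u x) (S.sigma (S.tau x u) z) = S.sigma u (S.sigma x z) ∧
    S.tau (S.sigma (S.tau x u) z) (S.sigma u x) = S.sigma (S.tau (S.sigma x z) u) (S.tau z x) ∧
    S.tau z (S.tau x u) = S.tau (S.tau z x) (S.tau (S.sigma x z) u) := by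
  have h := congrFun S.yangBaxter (u, x, z)
  have h1 := congrArg Prod.fst h
  have h2 := congrArg (fun t => t.2.1) h
  have h3 := congrArg (fun t => t.2.2) h
  exact ⟨h1, h2, h3⟩

/-- With `y = τ_x u`, the element `x ◁ y` is `τ_y (σ_u x)`. The law for `τ` moves `τ_z` past `τ_y`,
and the middle component rewrites what remains. -/
theorem tau_rackOp (z x y : X) :
    S.tau z (S.rackOp x y) = S.rackOp (S.tau z x) (S.tau z y) := by
  obtain ⟨u, rfl⟩ := (S.tau x).surjective y
  obtain ⟨-, h2, h3⟩ := S.yangBaxter_components u x z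
  have h4 := (S.yangBaxter_components (S.sigma u x) (S.tau x u) z).2.2
  unfold rackOp
  rw [Equiv.symm_apply_apply, h4, h2]
  congr 2
  rw [h3, Equiv.symm_apply_apply]

/-- The map `y ↦ τ_y⁻¹ y` is bijective. -/
theorem bijective_tau_symm_self [Finite X] :
    Function.Bijective fun y : X => (S.tau y).symm y := by
  rw [← Finite.surjective_iff_bijective]
  intro w
  obtain ⟨y, hy⟩ := (S.sigma w).surjective w
  -- With `σ_w y = w` and `τ_w v = w`, the law for `τ` at `(v, w, y)` says that `τ_y w` is fixed as
  -- required.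
  refine ⟨S.tau y w, ?_⟩
  have h : S.tau y w = S.tau (S.tau y w) w := by
    obtain ⟨v, hv⟩ := (S.tau w).surjective w
    have h3 := (S.yangBaxter_components v w y).2.2
    rw [hy, hv] at h3
    exact h3
  exact (Equiv.symm_apply_eq _).mpr h

/-- The homomorphism from the structure group to `Perm X` that sends `x` to `τ_x⁻¹`. -/
noncomputable def tauInvHom : S.StructureGroup →* Equiv.Perm X :=
  PresentedGroup.toGroup (f := fun x => (S.tau x)⁻¹) (by
    rintro _ ⟨x, y, rfl⟩
    simp only [map_mul, map_inv, FreeGroup.lift_apply_of]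
    rw [mul_inv_eq_one, ← mul_inv_rev, ← mul_inv_rev, inv_inj]
    ext u
    exact (S.yangBaxter_components u x y).2.2)

/-- The image of `x` in the structure group. -/
def gen (x : X) : S.StructureGroup := PresentedGroup.of x

@[simp]
theorem tauInvHom_gen (x : X) : S.tauInvHom (S.gen x) = (S.tau x)⁻¹ :=
  PresentedGroup.toGroup.of _

theorem gen_mul_gen (x y : X) :
    S.gen x * S.gen y = S.gen (S.sigma x y) * S.gen (S.tau y x) :=
  mul_inv_eq_one.mp (PresentedGroup.one_of_mem ⟨x, y, rfl⟩)

theorem closure_range_gen : Subgroup.closure (Set.range S.gen) = ⊤ :=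
  PresentedGroup.closure_range_of _

theorem tauInvHom_rackOp (g : S.StructureGroup) (x y : X) :
    S.tauInvHom g (S.rackOp x y) = S.rackOp (S.tauInvHom g x) (S.tauInvHom g y) := by
  have hg : g ∈ Subgroup.closure (Set.range S.gen) := S.closure_range_gen ▸ Subgroup.mem_top g
  induction hg using Subgroup.closure_induction generalizing x y with
  | mem g hg =>
    obtain ⟨z, rfl⟩ := hg
    rw [tauInvHom_gen, Equiv.Perm.inv_eq_iff_eq, tau_rackOp, Equiv.Perm.coe_inv,
      Equiv.apply_symm_apply, Equiv.apply_symm_apply]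
  | one => simp
  | mul a b _ _ iha ihb => simp only [map_mul, Equiv.Perm.mul_apply, ihb, iha]
  | inv a _ iha =>
    rw [map_inv, Equiv.Perm.inv_eq_iff_eq, iha, Equiv.Perm.coe_inv,
      Equiv.apply_symm_apply, Equiv.apply_symm_apply]

/-- The permutation `g ↦ (g • x) g` of the structure group, where `g • x` is the action through
`tauInvHom`. -/
noncomputable def shift [Finite X] (x : X) : Equiv.Perm S.StructureGroup :=
  Equiv.ofBijective (fun g => S.gen (S.tauInvHom g x) * g) (by
    -- The image `k` of `g` satisfies `k • x = τ_y⁻¹ y` with `y = g • x`; since `y ↦ τ_y⁻¹ y` is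
    -- bijective, `k` determines `y` and hence `g`.
    have key : ∀ (y : X) (g : S.StructureGroup), S.tauInvHom g x = y →
        (S.tau y).symm y = S.tauInvHom (S.gen y * g) x := by
      rintro y g rfl
      rw [map_mul, tauInvHom_gen, Equiv.Perm.mul_apply]
      rfl
    constructor
    · intro g h hgh
      have hy : S.tauInvHom g x = S.tauInvHom h x := by
        apply S.bijective_tau_symm_self.1
        change (S.tau _).symm _ = (S.tau _).symm _
        rw [key _ g rfl, key _ h rfl]
        exact congrArg (fun k => S.tauInvHom k x) hgh
      change S.gen (S.tauInvHom g x) * g = S.gen (S.tauInvHom h x) * h at hgh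
      rwa [hy, mul_right_inj] at hgh
    · intro k
      obtain ⟨y, hy⟩ := S.bijective_tau_symm_self.2 (S.tauInvHom k x)
      change (S.tau y).symm y = S.tauInvHom k x at hy
      refine ⟨(S.gen y)⁻¹ * k, ?_⟩
      have : S.tauInvHom ((S.gen y)⁻¹ * k) x = y := by
        rw [map_mul, map_inv, tauInvHom_gen, inv_inv, Equiv.Perm.mul_apply, ← hy,
          Equiv.apply_symm_apply]
      change S.gen (S.tauInvHom ((S.gen y)⁻¹ * k) x) * ((S.gen y)⁻¹ * k) = k
      rw [this, mul_inv_cancel_left])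

theorem shift_apply [Finite X] (x : X) (g : S.StructureGroup) :
    S.shift x g = S.gen (S.tauInvHom g x) * g := rfl

/-- At `g`, this is the defining relation `u v = σ_u(v) τ_v(u)` multiplied by `g`, where `v = g • y`
and `τ_v u = g • x`. -/
theorem shift_mul_shift [Finite X] (x y : X) :
    S.shift x * S.shift y = S.shift (S.rackOp y x) * S.shift x := by
  ext g
  simp only [Equiv.Perm.mul_apply, shift_apply, map_mul, tauInvHom_gen, ← mul_assoc]
  rw [tauInvHom_rackOp]
  generalize S.tauInvHom g x = x'
  generalize S.tauInvHom g y = v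
  obtain ⟨u, rfl⟩ := (S.tau v).surjective x'
  rw [Equiv.Perm.coe_inv, Equiv.symm_apply_apply, gen_mul_gen]
  congr 3
  unfold rackOp
  rw [Equiv.symm_apply_apply, Equiv.Perm.coe_inv, Equiv.symm_apply_apply]

theorem shift_apply_mul [Finite X] (x : X) (g h : S.StructureGroup)
    (hh : h ∈ S.tauInvHom.ker) : S.shift x (g * h) = S.shift x g * h := by
  rw [shift_apply, shift_apply, map_mul, MonoidHom.mem_ker.mp hh, mul_one, mul_assoc]

/-! ### The affine action and the degree -/

/-- The permutation of the rack orbits induced by an element of the structure group. -/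
noncomputable def orbitPerm : S.StructureGroup →* Equiv.Perm (Quotient S.rackOrbitRel) where
  toFun g :=
    have hmap : ∀ g x y, S.rackOrbitRel x y →
        S.rackOrbitRel (S.tauInvHom g x) (S.tauInvHom g y) := fun g x y h => by
      change Relation.EqvGen _ _ _ at h ⊢
      induction h with
      | rel x y h =>
        obtain ⟨w, rfl⟩ := h
        exact .rel _ _ ⟨S.tauInvHom g w, S.tauInvHom_rackOp g x w⟩
      | refl => exact .refl _
      | symm _ _ _ ih => exact .symm _ _ ih
      | trans _ _ _ _ _ ih₁ ih₂ => exact .trans _ _ _ ih₁ ih₂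
    Quotient.congr (S.tauInvHom g) fun x y => ⟨hmap g x y, fun h => by
      simpa using hmap g⁻¹ _ _ h⟩
  map_one' := by
    ext q
    induction q using Quotient.inductionOn
    simp
  map_mul' a b := by
    ext q
    induction q using Quotient.inductionOn
    simp

theorem orbitPerm_mk (g : S.StructureGroup) (x : X) :
    S.orbitPerm g (Quotient.mk _ x) = Quotient.mk _ (S.tauInvHom g x) := rfl

open Classical in
/-- The affine permutation `m ↦ τ_x m + [x]` of the free abelian group on the rack orbits. -/
noncomputable def affinePerm (x : X) : Equiv.Perm (Quotient S.rackOrbitRel → ℤ) :=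
  (Equiv.arrowCongr (S.orbitPerm (S.gen x))⁻¹ (Equiv.refl ℤ)).trans
    (Equiv.addRight (Pi.single (Quotient.mk _ x) 1))

open Classical in
theorem affinePerm_apply (x : X) (m : Quotient S.rackOrbitRel → ℤ) (q : Quotient S.rackOrbitRel) :
    S.affinePerm x m q = m (S.orbitPerm (S.gen x) q) +
      (Pi.single (Quotient.mk _ x) 1 : Quotient S.rackOrbitRel → ℤ) q := rfl

open Classical in
theorem single_orbitPerm (g : S.StructureGroup) (x : X) (q : Quotient S.rackOrbitRel) :
    (Pi.single (Quotient.mk _ x) 1 : Quotient S.rackOrbitRel → ℤ) (S.orbitPerm g q) =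
      (Pi.single (Quotient.mk _ (S.tauInvHom g⁻¹ x)) 1 : Quotient S.rackOrbitRel → ℤ) q := by
  have h : S.orbitPerm g q = Quotient.mk _ x ↔ q = Quotient.mk _ (S.tauInvHom g⁻¹ x) := by
    rw [← orbitPerm_mk, map_inv, Equiv.Perm.eq_inv_iff_eq]
  simp only [Pi.single_apply, h]

/-- The action of the structure group on the free abelian group on the rack orbits in which
`x⁻¹` acts as `affinePerm x`. -/
noncomputable def affineAction :
    S.StructureGroup →* Equiv.Perm (Quotient S.rackOrbitRel → ℤ) :=
  PresentedGroup.toGroup (f := fun x => (S.affinePerm x)⁻¹) (by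
    classical
    rintro _ ⟨x, y, rfl⟩
    simp only [map_mul, map_inv, FreeGroup.lift_apply_of]
    rw [mul_inv_eq_one, ← mul_inv_rev, ← mul_inv_rev, inv_inj]
    ext m q
    have hact : S.orbitPerm (S.gen x) (S.orbitPerm (S.gen y) q) =
        S.orbitPerm (S.gen (S.sigma x y)) (S.orbitPerm (S.gen (S.tau y x)) q) := by
      rw [← Equiv.Perm.mul_apply, ← map_mul, gen_mul_gen, map_mul, Equiv.Perm.mul_apply]
    -- The translation parts agree only modulo rack orbits: `τ_{τ_y x} (σ_x y)` is `y ◁ τ_y x`.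
    have hrel : (Quotient.mk S.rackOrbitRel y) =
        Quotient.mk _ (S.tau (S.tau y x) (S.sigma x y)) := by
      refine Quotient.sound (Relation.EqvGen.rel _ _ ⟨S.tau y x, ?_⟩)
      rw [rackOp, Equiv.symm_apply_apply]
    simp only [Equiv.Perm.mul_apply, affinePerm_apply, hact, single_orbitPerm, map_inv,
      tauInvHom_gen, inv_inv]
    rw [← hrel]
    ring)

@[simp]
theorem affineAction_gen (x : X) : S.affineAction (S.gen x) = (S.affinePerm x)⁻¹ :=
  PresentedGroup.toGroup.of _

open Classical in
theorem affineAction_add_single (g : S.StructureGroup) (m : Quotient S.rackOrbitRel → ℤ) (y : X) :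
    S.affineAction g (m + Pi.single (Quotient.mk _ y) 1) =
      S.affineAction g m + Pi.single (Quotient.mk _ (S.tauInvHom g y)) 1 := by
  have hx : ∀ x m y, S.affinePerm x (m + Pi.single (Quotient.mk _ y) 1) =
      S.affinePerm x m + Pi.single (Quotient.mk _ (S.tau x y)) 1 := by
    intro x m y
    ext q
    simp only [affinePerm_apply, Pi.add_apply, single_orbitPerm, map_inv, tauInvHom_gen, inv_inv]
    ring
  have hg : g ∈ Subgroup.closure (Set.range S.gen) := S.closure_range_gen ▸ Subgroup.mem_top g
  induction hg using Subgroup.closure_induction generalizing m y with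
  | mem g hg =>
    obtain ⟨z, rfl⟩ := hg
    rw [affineAction_gen, tauInvHom_gen, Equiv.Perm.inv_eq_iff_eq, hx, Equiv.Perm.coe_inv,
      Equiv.apply_symm_apply, Equiv.Perm.coe_inv, Equiv.apply_symm_apply]
  | one => simp
  | mul a b _ _ iha ihb => simp only [map_mul, Equiv.Perm.mul_apply, ihb, iha]
  | inv a _ iha =>
    rw [map_inv, map_inv, Equiv.Perm.inv_eq_iff_eq, iha, Equiv.Perm.coe_inv,
      Equiv.apply_symm_apply, Equiv.Perm.coe_inv, Equiv.apply_symm_apply]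

/-- The degree cocycle, with values in the free abelian group on the rack orbits. -/
noncomputable def degree (g : S.StructureGroup) : Quotient S.rackOrbitRel → ℤ :=
  S.affineAction g⁻¹ 0

theorem degree_one : S.degree 1 = 0 := by simp [degree]

open Classical in
-- The new letter `g • x` contributes its class twisted by `g⁻¹`, which undoes the twist and leaves
-- `[x]`.
theorem degree_shift [Finite X] (x : X) (g : S.StructureGroup) :
    S.degree (S.shift x g) = S.degree g + Pi.single (Quotient.mk _ x) 1 := by
  have h0 : S.affinePerm (S.tauInvHom g x) 0 =
      0 + Pi.single (Quotient.mk _ (S.tauInvHom g x)) 1 := by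
    ext q
    simp [affinePerm_apply]
  rw [shift_apply, degree, mul_inv_rev, map_mul, Equiv.Perm.mul_apply, map_inv, map_inv, affineAction_gen,
    inv_inv, h0, ← map_inv, affineAction_add_single, map_inv S.tauInvHom, Equiv.Perm.coe_inv, Equiv.symm_apply_apply, degree]

/-! ### The group generated by the shifts, and conclusion -/

/-- The group of permutations of the structure group generated by the shifts. -/
def ShiftGroup [Finite X] : Subgroup (Equiv.Perm S.StructureGroup) :=
  Subgroup.closure (Set.range S.shift)

/-- A shift as an element of `ShiftGroup`. -/
noncomputable def shiftGen [Finite X] (x : X) : S.ShiftGroup :=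
  ⟨S.shift x, Subgroup.subset_closure ⟨x, rfl⟩⟩

theorem closure_range_shiftGen [Finite X] : Subgroup.closure (Set.range S.shiftGen) = ⊤ := by
  refine Eq.trans ?_ (Subgroup.closure_closure_coe_preimage (k := Set.range S.shift))
  congr 1
  ext a
  constructor
  · rintro ⟨x, rfl⟩
    exact ⟨x, rfl⟩
  · rintro ⟨x, hx⟩
    exact ⟨x, Subtype.ext hx⟩

theorem shiftGroup_induction [Finite X] {p : S.ShiftGroup → Prop} (hgen : ∀ x, p (S.shiftGen x))
    (hone : p 1) (hmul : ∀ a b, p a → p b → p (a * b)) (hinv : ∀ a, p a → p a⁻¹)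
    (a : S.ShiftGroup) : p a := by
  have ha : a ∈ Subgroup.closure (Set.range S.shiftGen) :=
    S.closure_range_shiftGen ▸ Subgroup.mem_top a
  induction ha using Subgroup.closure_induction with
  | mem a ha => obtain ⟨x, rfl⟩ := ha; exact hgen x
  | one => exact hone
  | mul a b _ _ iha ihb => exact hmul a b iha ihb
  | inv a _ iha => exact hinv a iha

/-- Every shift changes the degree by a constant, hence so does every product of shifts and their
inverses; the constant is read off at `1`. -/
theorem degree_smul [Finite X] (a : S.ShiftGroup) (g : S.StructureGroup) :
    S.degree (a • g) = S.degree g + S.degree (a • (1 : S.StructureGroup)) := by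
  classical
  have h : ∃ c, ∀ g : S.StructureGroup, S.degree (a • g) = S.degree g + c := by
    induction a using S.shiftGroup_induction with
    | hgen x => exact ⟨_, S.degree_shift x⟩
    | hone => exact ⟨0, fun g => by rw [one_smul, add_zero]⟩
    | hmul a b iha ihb =>
      obtain ⟨c, hc⟩ := iha
      obtain ⟨d, hd⟩ := ihb
      exact ⟨d + c, fun g => by rw [mul_smul, hc, hd, add_assoc]⟩
    | hinv a iha =>
      obtain ⟨c, hc⟩ := iha
      exact ⟨-c, fun g => by
        rw [eq_add_neg_iff_add_eq, ← hc, smul_inv_smul]⟩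
  obtain ⟨c, hc⟩ := h
  rw [hc g, hc 1, degree_one, zero_add]

/-- The degree as a homomorphism on `ShiftGroup`. -/
noncomputable def shiftDegree [Finite X] :
    S.ShiftGroup →* Multiplicative (Quotient S.rackOrbitRel → ℤ) where
  toFun a := Multiplicative.ofAdd (S.degree (a • (1 : S.StructureGroup)))
  map_one' := by rw [one_smul, degree_one, ofAdd_zero]
  map_mul' a b := by rw [mul_smul, degree_smul, add_comm, ofAdd_add]

theorem smul_mul_of_mem_ker [Finite X] (a : S.ShiftGroup) (g h : S.StructureGroup)
    (hh : h ∈ S.tauInvHom.ker) : a • (g * h) = (a • g) * h := by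
  induction a using S.shiftGroup_induction generalizing g with
  | hgen x => exact S.shift_apply_mul x g h hh
  | hone => simp
  | hmul a b iha ihb => rw [mul_smul, ihb, iha, mul_smul]
  | hinv a iha => rw [inv_smul_eq_iff, iha, smul_inv_smul]

/-- Left multiplication of `k` by the generator `y` is the shift by `k⁻¹ • y`, so any word can be
built up from `1`. -/
theorem exists_smul_one_eq [Finite X] (g : S.StructureGroup) :
    ∃ a : S.ShiftGroup, a • (1 : S.StructureGroup) = g := by
  have key : ∀ (y : X) (k : S.StructureGroup),
      S.shiftGen (S.tauInvHom k⁻¹ y) • k = S.gen y * k := by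
    intro y k
    change S.shift _ k = _
    rw [shift_apply, map_inv, Equiv.Perm.coe_inv, Equiv.apply_symm_apply]
  have hg : g ∈ Subgroup.closure (Set.range S.gen) := S.closure_range_gen ▸ Subgroup.mem_top g
  induction hg using Subgroup.closure_induction_left with
  | one => exact ⟨1, one_smul _ _⟩
  | mul_left x hx k _ ih =>
    obtain ⟨y, rfl⟩ := hx
    obtain ⟨a, rfl⟩ := ih
    exact ⟨S.shiftGen _ * a, by rw [mul_smul, key]⟩
  | inv_mul_cancel x hx k _ ih =>
    obtain ⟨y, rfl⟩ := hx
    obtain ⟨a, rfl⟩ := ih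
    refine ⟨(S.shiftGen (S.tauInvHom ((S.gen y)⁻¹ * a • (1 : S.StructureGroup))⁻¹ y))⁻¹ * a, ?_⟩
    rw [mul_smul, inv_smul_eq_iff, key, mul_inv_cancel_left]

theorem isVirtually [Finite X] :
    IsVirtually S.StructureGroup (Multiplicative (Fin S.numRackOrbits → ℤ)) := by
  classical
  obtain ⟨ζ, hζ, hinj⟩ := exists_freeAbelian_finiteIndex S.shiftGen (fun x y => S.rackOp x y)
    (fun x y => Subtype.ext (S.shift_mul_shift x y)) S.closure_range_shiftGen S.rackOrbitRel rfl
    S.shiftDegree (fun x => by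
      change Multiplicative.ofAdd (S.degree (S.shift x 1)) = _
      rw [degree_shift, degree_one, zero_add])
  have : S.tauInvHom.ker.FiniteIndex := Subgroup.finiteIndex_ker _
  obtain ⟨K, f, hK, hf, hfr⟩ := exists_finiteIndex_embedding_of_action S.tauInvHom.ker
    (fun a g h hh => S.smul_mul_of_mem_ker a g h hh) S.exists_smul_one_eq ζ hζ (fun m hm => by
      -- If `ζ m` fixes `1`, its degree is zero, and degree after `ζ` is injective.
      apply hinj
      change Multiplicative.ofAdd (S.degree (ζ m • (1 : S.StructureGroup))) = _
      rw [hm, degree_one, map_one, ofAdd_zero])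
  exact ⟨K, hK, nonempty_mulEquiv_of_finiteIndex_range f hf hfr⟩

theorem subsingleton_structureGroup [Finite X] (h : S.numRackOrbits = 0) :
    Subsingleton S.StructureGroup := by
  have hX : IsEmpty X := by
    rw [numRackOrbits, Finite.card_eq_zero_iff] at h
    exact ⟨fun x => h.false (Quotient.mk _ x)⟩
  have hbot : (⊤ : Subgroup S.StructureGroup) = ⊥ := by
    rw [← S.closure_range_gen, Set.range_eq_empty, Subgroup.closure_empty]
  exact (Subgroup.subsingleton_iff).mp (subsingleton_of_bot_eq_top hbot.symm)

end YBESolution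

theorem mainTheorem9 {X : Type*} [Finite X] (S : YBESolution X) :
    IsVirtually S.StructureGroup (Multiplicative (Fin S.numRackOrbits → ℤ)) ∧
    (IsLinearGroup ℝ S.StructureGroup ∧
      ∃ Z : Subgroup S.StructureGroup, Z.Normal ∧ Z.FiniteIndex ∧
        Nonempty (Z ≃* Multiplicative (Fin S.numRackOrbits → ℤ)) ∧
        ∃ ρ : Representation ℝ Z (Fin S.numRackOrbits → ℝ),
          Function.Injective ρ ∧ Function.Injective (Representation.ind Z.subtype ρ)) ∧
    Group.ResiduallyFinite S.StructureGroup := by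
  exact ⟨S.isVirtually, S.isVirtually.linear_and_residuallyFinite S.subsingleton_structureGroup⟩
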